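/- Let $m,n$ be natural numbers with $m=2$ or $n=2$, and let $n_0=\min\{m,n\}$. For $B\in\mathbb{M}_{m\times n}(\mathbb{C})$ let $\boldsymbol\sigma(B)=(\sigma_1(B),\ldots,\sigma_{n_0}(B))$ be the vector of singular values of $B$ in non-increasing order, counted with multiplicity, and for $1<p<\infty$ let $\|B\|_p=\big(\sum_{i=1}^{n_0}\sigma_i(B)^p\big)^{1/p}$ be the Schatten $p$-norm ($c_p$-norm). Let $\mathcal{M}$ be a linear subspace of $\mathbb{M}_{m\times n}(\mathbb{C})$ (a real-linear subspace suffices; in particular $\mathcal M$ may be any complex subspace) and let $A\in\mathbb{M}_{m\times n}(\mathbb{C})$. Then: 1. for every real $p$ with $1<p<\infty$ there is a unique $Y_p\in\mathcal{M}$, the $c_p$-approximation of $A$, such that $\|A-Y_p\|_p=\min_{X\in\mathcal{M}}\|A-X\|_p$; 2. there is a unique $Y^{(st)}\in\mathcal{M}$, the strict spectral approximation of $A$, such that $\boldsymbol\sigma(A-Y^{(st)})$ is minimal with respect to the lexicographic ordering on the set $\{\boldsymbol\sigma(A-X):X\in\mathcal{M}\}$; 3. $Y_p\to Y^{(st)}$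 as $p\to\infty$. -/

import Mathlib

open Filter Topology

namespace SpectralApprox

/-- The vector `σ(A) = (σ₁(A), …, σ_{n₀}(A))`, `n₀ = min m n`, of singular values of a complex
`m × n` matrix in non-increasing order, counted with multiplicity. Indices start at `0`, so the
largest singular value is the entry with index `0`. -/
noncomputable def sigma {m n : ℕ} (A : Matrix (Fin m) (Fin n) ℂ) : Fin (min m n) → ℝ :=
  fun i => (Matrix.toEuclideanLin A).singularValues (i : ℕ)

/-- The Schatten `p`-norm (`c_p`-norm) `(∑ᵢ σᵢ(A)ᵖ)^(1/p)`. -/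
noncomputable def cpNorm {m n : ℕ} (p : ℝ) (A : Matrix (Fin m) (Fin n) ℂ) : ℝ :=
  (∑ i, sigma A i ^ p) ^ (1 / p)

/-- `Y` is a best approximation of `A` in the set `M` with respect to the `c_p`-norm. -/
def IsCpApprox {m n : ℕ} (M : Set (Matrix (Fin m) (Fin n) ℂ)) (A : Matrix (Fin m) (Fin n) ℂ)
    (p : ℝ) (Y : Matrix (Fin m) (Fin n) ℂ) : Prop :=
  Y ∈ M ∧ ∀ X ∈ M, cpNorm p (A - Y) ≤ cpNorm p (A - X)

/-- `Y` is a strict spectral approximation of `A` in the set `M`: the vector `σ(A - Y)` is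
lexicographically minimal among the vectors `σ(A - X)`, `X ∈ M`. -/
def IsStrictSpectralApprox {m n : ℕ} (M : Set (Matrix (Fin m) (Fin n) ℂ))
    (A : Matrix (Fin m) (Fin n) ℂ) (Y : Matrix (Fin m) (Fin n) ℂ) : Prop :=
  Y ∈ M ∧ ∀ X ∈ M, toLex (sigma (A - Y)) ≤ toLex (sigma (A - X))

end SpectralApprox

namespace SpectralApprox

/-! Only σ₁ and σ₂ can be nonzero. Both σ₁ and σ₁ + σ₂ are pointwise maxima of real-linear
functionals, and σ₁² + σ₂² is the squared Frobenius norm, which obeys the parallelogram law;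
`SpectralPair` records this. Hence the pair (σ₁, σ₂) at the midpoint of two errors is weakly
majorized by the average of their pairs. If both errors are minimal, lexicographically or in ℓ^p
(via `strict_weak_majorization`), all three pairs coincide, and the parallelogram law makes the
errors equal. Existence is coercivity and compactness.

For the limit, compare the ℓ^p minimizer B_p with the lexicographic minimizer b: σ₁(b) ≤ σ₁(B_p) ≤
2^(1/p) σ₁(b), and the lower bound forces σ₂(B_p) ≤ σ₂(b). So every cluster point of B_p as p → ∞ is
a lexicographic minimizer, that is, b. -/

theorem strict_weak_majorization {p a b c d : ℝ} (hp : 1 < p) (hb : 0 ≤ b) (hba : b ≤ a)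
    (hd : 0 ≤ d) (hdc : d ≤ c) (hca : c ≤ a) (hsum : c + d ≤ a + b)
    (h : a ^ p + b ^ p ≤ c ^ p + d ^ p) : c = a ∧ d = b := by
  have hp0 : 0 < p := by linarith
  have mono : ∀ {x y : ℝ}, 0 ≤ x → x < y → x ^ p < y ^ p := fun hx hxy =>
    Real.rpow_lt_rpow hx hxy hp0
  rcases eq_or_lt_of_le hca with hca' | hca'
  · subst hca'
    refine ⟨rfl, le_antisymm (by linarith) ?_⟩
    by_contra hlt
    have := mono hd (not_le.mp hlt)
    linarith
  · exfalso
    have hc := mono (hd.trans hdc) hca'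
    rcases le_or_gt d b with hdb | hdb
    · have := Real.rpow_le_rpow hd hdb hp0.le
      linarith
    -- Here c ≤ e, while d and e are convex combinations of a and b with swapped weights, so strict
    -- convexity gives d^p + e^p < a^p + b^p.
    · set e := a + b - d with he
      have hce : c ^ p ≤ e ^ p := Real.rpow_le_rpow (hd.trans hdc) (by linarith) hp0.le
      have hab : b < a := by linarith
      have hab' : a - b ≠ 0 := by linarith
      set u := (d - b) / (a - b) with hu
      have hu0 : 0 < u := div_pos (by linarith) (by linarith)
      have hu1 : 0 < 1 - u := by
        rw [sub_pos, hu, div_lt_one (by linarith)]; linarith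
      have hcv := strictConvexOn_rpow hp
      have h1 := hcv.2 (show a ∈ Set.Ici 0 from hb.trans hba) (show b ∈ Set.Ici 0 from hb)
        hab.ne' hu0 hu1 (by ring)
      have h2 := hcv.2 (show b ∈ Set.Ici 0 from hb) (show a ∈ Set.Ici 0 from hb.trans hba)
        hab.ne hu0 hu1 (by ring)
      simp only [smul_eq_mul] at h1 h2
      have e1 : u * a + (1 - u) * b = d := by rw [hu]; field_simp; ring
      have e2 : u * b + (1 - u) * a = e := by rw [he, ← e1]; ring
      rw [e1] at h1
      rw [e2] at h2
      nlinarith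

theorem rpow_midpoint_le {p a b : ℝ} (hp : 1 < p) (ha : 0 ≤ a) (hb : 0 ≤ b) :
    ((a + b) / 2) ^ p ≤ (a ^ p + b ^ p) / 2 := by
  have := (convexOn_rpow hp.le).2 (show a ∈ Set.Ici 0 from ha) (show b ∈ Set.Ici 0 from hb)
    (show (0 : ℝ) ≤ 1 / 2 by norm_num) (show (0 : ℝ) ≤ 1 / 2 by norm_num) (by norm_num)
  simp only [smul_eq_mul] at this
  rwa [show 1 / 2 * a + 1 / 2 * b = (a + b) / 2 by ring,
    show 1 / 2 * a ^ p + 1 / 2 * b ^ p = (a ^ p + b ^ p) / 2 by ring] at this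

theorem rpow_midpoint_lt {p a b : ℝ} (hp : 1 < p) (ha : 0 ≤ a) (hb : 0 ≤ b) (hab : a ≠ b) :
    ((a + b) / 2) ^ p < (a ^ p + b ^ p) / 2 := by
  have := (strictConvexOn_rpow hp).2 (show a ∈ Set.Ici 0 from ha) (show b ∈ Set.Ici 0 from hb) hab
    (show (0 : ℝ) < 1 / 2 by norm_num) (show (0 : ℝ) < 1 / 2 by norm_num) (by norm_num)
  simp only [smul_eq_mul] at this
  rwa [show 1 / 2 * a + 1 / 2 * b = (a + b) / 2 by ring,
    show 1 / 2 * a ^ p + 1 / 2 * b ^ p = (a ^ p + b ^ p) / 2 by ring] at this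

/-! ### Pointwise maxima of linear functionals -/

/-- `f` is the pointwise maximum of the linear functionals below it. -/
def HasSupport {V : Type*} [AddCommGroup V] [Module ℝ V] (f : V → ℝ) : Prop :=
  ∀ x, ∃ φ : V →ₗ[ℝ] ℝ, φ x = f x ∧ ∀ y, φ y ≤ f y

namespace HasSupport

variable {V : Type*} [AddCommGroup V] [Module ℝ V] {f : V → ℝ}

theorem midpoint_le (hf : HasSupport f) (x y : V) :
    f ((1 / 2 : ℝ) • (x + y)) ≤ (f x + f y) / 2 := by
  obtain ⟨φ, h1, h2⟩ := hf ((1 / 2 : ℝ) • (x + y))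
  rw [← h1, map_smul, map_add, smul_eq_mul]
  linarith [h2 x, h2 y]

theorem add_le (hf : HasSupport f) (x y : V) : f (x + y) ≤ f x + f y := by
  obtain ⟨φ, h1, h2⟩ := hf (x + y)
  rw [← h1, map_add]
  linarith [h2 x, h2 y]

end HasSupport

theorem HasSupport.continuous {V : Type*} [NormedAddCommGroup V] [NormedSpace ℝ V] {f : V → ℝ}
    (hf : HasSupport f) {C : ℝ} (hC : ∀ x, f x ≤ C * ‖x‖) : Continuous f := by
  refine continuous_iff_continuousAt.mpr fun x => ?_
  refine (tendsto_iff_norm_sub_tendsto_zero).mpr ?_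
  have h0 : Tendsto (fun y => C * ‖y - x‖) (𝓝 x) (𝓝 0) := by
    have : Continuous fun y => C * ‖y - x‖ := by fun_prop
    simpa using this.tendsto x
  refine squeeze_zero (fun _ => norm_nonneg _) (fun y => ?_) h0
  rw [Real.norm_eq_abs, abs_le]
  have h1 := hf.add_le x (y - x)
  have h2 := hf.add_le y (x - y)
  have h3 := hC (y - x)
  have h4 := hC (x - y)
  rw [norm_sub_rev] at h4
  simp only [add_sub_cancel] at h1 h2
  constructor <;> linarith

/-! ### Minimization for an abstract spectral pair -/

/-- The properties of the two largest singular values `s ≥ t` of a matrix of rank at most two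
on which the approximation results rest; the norm is the Frobenius norm. -/
structure SpectralPair {V : Type*} [NormedAddCommGroup V] [NormedSpace ℝ V] (s t : V → ℝ) :
    Prop where
  nonneg : ∀ x, 0 ≤ t x
  le : ∀ x, t x ≤ s x
  sq_add_sq : ∀ x, s x ^ 2 + t x ^ 2 = ‖x‖ ^ 2
  parallelogram : ∀ x y : V, ‖x + y‖ ^ 2 + ‖x - y‖ ^ 2 = 2 * (‖x‖ ^ 2 + ‖y‖ ^ 2)
  support : HasSupport s
  support_add : HasSupport fun x => s x + t x

namespace SpectralPair

variable {V : Type*} [NormedAddCommGroup V] [NormedSpace ℝ V] {s t : V → ℝ}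

theorem fst_nonneg (h : SpectralPair s t) (x : V) : 0 ≤ s x := (h.nonneg x).trans (h.le x)

theorem fst_le_norm (h : SpectralPair s t) (x : V) : s x ≤ ‖x‖ :=
  le_of_sq_le_sq (by nlinarith [h.sq_add_sq x, sq_nonneg (t x)]) (norm_nonneg x)

theorem norm_le_two_mul (h : SpectralPair s t) (x : V) : ‖x‖ ≤ 2 * s x := by
  have := h.fst_nonneg x
  refine le_of_sq_le_sq ?_ (by linarith)
  nlinarith [h.sq_add_sq x, h.nonneg x, h.le x]

theorem continuous_fst (h : SpectralPair s t) : Continuous s :=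
  h.support.continuous (C := 1) fun x => by simpa using h.fst_le_norm x

theorem continuous_add (h : SpectralPair s t) : Continuous fun x => s x + t x :=
  h.support_add.continuous (C := 2) fun x => by linarith [h.fst_le_norm x, h.le x]

theorem continuous_snd (h : SpectralPair s t) : Continuous t := by
  have : t = fun x => s x + t x - s x := by ext x; ring
  rw [this]
  exact h.continuous_add.sub h.continuous_fst

theorem eq_of_midpoint (h : SpectralPair s t) {x y : V} (hs : s x = s y) (ht : t x = t y)
    (hs' : s ((1 / 2 : ℝ) • (x + y)) = s x) (ht' : t ((1 / 2 : ℝ) • (x + y)) = t x) : x = y := by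
  have h1 := h.sq_add_sq x
  have h2 := h.sq_add_sq y
  have h3 := h.sq_add_sq ((1 / 2 : ℝ) • (x + y))
  have h4 := h.parallelogram x y
  rw [hs', ht', norm_smul, mul_pow] at h3
  norm_num at h3
  rw [← hs, ← ht] at h2
  have : ‖x - y‖ ^ 2 = 0 := by nlinarith
  rw [sq_eq_zero_iff, norm_sub_eq_zero_iff] at this
  exact this

theorem exists_isMinOn [FiniteDimensional ℝ V] {K : Set V} (hK : IsClosed K) (hne : K.Nonempty)
    {g : V → ℝ} (hg : Continuous g) (hcoer : ∀ x, ‖x‖ ≤ 2 * g x) :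
    ∃ x ∈ K, ∀ y ∈ K, g x ≤ g y := by
  have : ProperSpace V := FiniteDimensional.proper ℝ V
  obtain ⟨x₀, hx₀⟩ := hne
  have hev : ∀ᶠ x in cocompact V ⊓ 𝓟 K, g x₀ ≤ g x := by
    refine Filter.Eventually.filter_mono inf_le_left ?_
    filter_upwards [(tendsto_norm_cocompact_atTop (E := V)).eventually_ge_atTop (2 * g x₀)]
      with x hx
    linarith [hcoer x]
  exact hg.continuousOn.exists_isMinOn' hK hx₀ hev

/-- `x` minimises `(s, t)` lexicographically on `K`. -/
def IsLexMin (s t : V → ℝ) (K : Set V) (x : V) : Prop :=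
  x ∈ K ∧ ∀ y ∈ K, s x < s y ∨ s x = s y ∧ t x ≤ t y

/-- `x` minimises the `ℓ^p` norm of `(s, t)` on `K`. -/
def IsPowMin (s t : V → ℝ) (K : Set V) (p : ℝ) (x : V) : Prop :=
  x ∈ K ∧ ∀ y ∈ K, s x ^ p + t x ^ p ≤ s y ^ p + t y ^ p

variable {K : Set V}

theorem mid_mem (hconv : Convex ℝ K) {x y : V} (hx : x ∈ K) (hy : y ∈ K) :
    (1 / 2 : ℝ) • (x + y) ∈ K := by
  rw [smul_add]
  exact hconv hx hy (by norm_num) (by norm_num) (by norm_num)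

omit [NormedAddCommGroup V] [NormedSpace ℝ V] in
theorem IsLexMin.fst_le {x : V} (hx : IsLexMin s t K x) {y : V} (hy : y ∈ K) : s x ≤ s y := by
  rcases hx.2 y hy with h | h
  exacts [h.le, h.1.le]

theorem exists_isLexMin [FiniteDimensional ℝ V] (h : SpectralPair s t) (hK : IsClosed K)
    (hne : K.Nonempty) : ∃ x, IsLexMin s t K x := by
  obtain ⟨a, ha, hamin⟩ := exists_isMinOn hK hne h.continuous_fst h.norm_le_two_mul
  -- On this set `s` is constant, so minimizing `s + t` minimizes `t`; unlike `t`, the sum is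
  -- coercive.
  obtain ⟨x, hx, hxmin⟩ := exists_isMinOn (K := K ∩ {x | s x ≤ s a})
    (hK.inter (isClosed_le h.continuous_fst continuous_const)) ⟨a, ha, le_refl (s a)⟩ h.continuous_add
    (fun x => by linarith [h.norm_le_two_mul x, h.nonneg x])
  have hsx : s x = s a := le_antisymm hx.2 (hamin x hx.1)
  refine ⟨x, hx.1, fun y hy => ?_⟩
  rcases (hamin y hy).lt_or_eq with hlt | heq
  · exact Or.inl (hsx ▸ hlt)
  · refine Or.inr ⟨hsx.trans heq, ?_⟩
    have := hxmin y ⟨hy, heq.ge⟩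
    linarith

theorem IsLexMin.unique (h : SpectralPair s t) (hconv : Convex ℝ K) {x y : V}
    (hx : IsLexMin s t K x) (hy : IsLexMin s t K y) : x = y := by
  have hs : s x = s y := le_antisymm (hx.fst_le hy.1) (hy.fst_le hx.1)
  have ht : t x = t y := by
    rcases hx.2 y hy.1 with h1 | h1
    · exact absurd hs h1.ne
    rcases hy.2 x hx.1 with h2 | h2
    · exact absurd hs.symm h2.ne
    exact le_antisymm h1.2 h2.2
  have hz := mid_mem hconv hx.1 hy.1
  have m1 := h.support.midpoint_le x y
  have m2 := h.support_add.midpoint_le x y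
  have hs' : s ((1 / 2 : ℝ) • (x + y)) = s x :=
    le_antisymm (by linarith) (hx.fst_le hz)
  refine h.eq_of_midpoint hs ht hs' (le_antisymm (by linarith) ?_)
  rcases hx.2 _ hz with h1 | h1
  · exact absurd hs'.symm h1.ne
  · exact h1.2

theorem exists_isPowMin [FiniteDimensional ℝ V] (h : SpectralPair s t) (hK : IsClosed K)
    (hne : K.Nonempty) {p : ℝ} (hp : 1 < p) : ∃ x, IsPowMin s t K p x := by
  have hp0 : 0 < p := by linarith
  have hnn : ∀ x, 0 ≤ s x ^ p + t x ^ p := fun x =>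
    add_nonneg (Real.rpow_nonneg (h.fst_nonneg x) _) (Real.rpow_nonneg (h.nonneg x) _)
  obtain ⟨x, hx, hmin⟩ := exists_isMinOn hK hne (g := fun x => (s x ^ p + t x ^ p) ^ (1 / p))
    (((h.continuous_fst.rpow_const fun _ => Or.inr hp0.le).add
      (h.continuous_snd.rpow_const fun _ => Or.inr hp0.le)).rpow_const
      fun _ => Or.inr (by positivity)) (fun x => by
      refine (h.norm_le_two_mul x).trans (mul_le_mul_of_nonneg_left ?_ (by norm_num))
      rw [one_div, Real.le_rpow_inv_iff_of_pos (h.fst_nonneg x) (hnn x) hp0]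
      linarith [Real.rpow_nonneg (h.nonneg x) p])
  refine ⟨x, hx, fun y hy => ?_⟩
  exact (Real.rpow_le_rpow_iff (hnn x) (hnn y) (by positivity)).mp (hmin y hy)

theorem IsPowMin.unique (h : SpectralPair s t) (hconv : Convex ℝ K) {p : ℝ} (hp : 1 < p) {x y : V}
    (hx : IsPowMin s t K p x) (hy : IsPowMin s t K p y) : x = y := by
  have hz := mid_mem hconv hx.1 hy.1
  have m1 := h.support.midpoint_le x y
  have m2 := h.support_add.midpoint_le x y
  have e1 := hx.2 _ hy.1
  have e2 := hy.2 _ hx.1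
  have e3 := hx.2 _ hz
  have c1 := rpow_midpoint_le hp (h.fst_nonneg x) (h.fst_nonneg y)
  have c2 := rpow_midpoint_le hp (h.nonneg x) (h.nonneg y)
  -- Minimality bounds the power sum at the midpoint below by the average of the two power sums,
  -- hence by the power sum of the averaged pair.
  obtain ⟨hs', ht'⟩ := strict_weak_majorization hp
    (a := (s x + s y) / 2) (b := (t x + t y) / 2)
    (by linarith [h.nonneg x, h.nonneg y]) (by linarith [h.le x, h.le y])
    (h.nonneg _) (h.le _) m1 (by linarith) (by linarith)
  rw [hs', ht'] at e3
  have hs : s x = s y := by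
    by_contra hne
    have := rpow_midpoint_lt hp (h.fst_nonneg x) (h.fst_nonneg y) hne
    linarith
  have ht : t x = t y := by
    by_contra hne
    have := rpow_midpoint_lt hp (h.nonneg x) (h.nonneg y) hne
    linarith
  exact h.eq_of_midpoint hs ht (by rw [hs']; linarith) (by rw [ht']; linarith)

theorem tendsto_of_isPowMin [FiniteDimensional ℝ V] (h : SpectralPair s t) (hK : IsClosed K)
    (hconv : Convex ℝ K) {B : ℝ → V} {b : V} (hB : ∀ p, 1 < p → IsPowMin s t K p (B p))
    (hb : IsLexMin s t K b) : Tendsto B atTop (𝓝 b) := by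
  have : ProperSpace V := FiniteDimensional.proper ℝ V
  have hsB : ∀ p, 1 < p → s (B p) ≤ 2 ^ (1 / p) * s b := fun p hp => by
    have hp0 : 0 < p := by linarith
    have h1 := (hB p hp).2 b hb.1
    have h2 := Real.rpow_nonneg (h.nonneg (B p)) p
    have h3 := Real.rpow_le_rpow (h.nonneg b) (h.le b) hp0.le
    have h4 : 0 ≤ (2 : ℝ) ^ (1 / p) * s b := mul_nonneg (by positivity) (h.fst_nonneg b)
    rw [← Real.rpow_le_rpow_iff (h.fst_nonneg _) h4 hp0,
      Real.mul_rpow (by positivity) (h.fst_nonneg b), ← Real.rpow_mul (by norm_num),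
      one_div_mul_cancel hp0.ne', Real.rpow_one]
    linarith
  have htB : ∀ p, 1 < p → t (B p) ≤ t b := fun p hp => by
    have hp0 : 0 < p := by linarith
    have h1 := (hB p hp).2 b hb.1
    have h2 := Real.rpow_le_rpow (h.fst_nonneg b) (hb.fst_le (hB p hp).1) hp0.le
    rw [← Real.rpow_le_rpow_iff (h.nonneg _) (h.nonneg b) hp0]
    linarith
  have hlim : Tendsto (fun p : ℝ => (2 : ℝ) ^ (1 / p) * s b) atTop (𝓝 (s b)) := by
    have h1 : Tendsto (fun p : ℝ => 1 / p) atTop (𝓝 0) := by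
      simpa using tendsto_inv_atTop_zero (𝕜 := ℝ)
    have h2 := (Real.continuous_const_rpow (a := 2) (by norm_num)).tendsto 0 |>.comp h1
    simpa using h2.mul_const (s b)
  have hev := eventually_gt_atTop (1 : ℝ)
  have hslim : Tendsto (fun p => s (B p)) atTop (𝓝 (s b)) :=
    tendsto_of_tendsto_of_tendsto_of_le_of_le' tendsto_const_nhds hlim
      (hev.mono fun p hp => hb.fst_le (hB p hp).1) (hev.mono hsB)
  -- The radius comes from ‖x‖ ≤ 2 s x and, eventually, s (B p) < s b + 1.
  refine (isCompact_closedBall (0 : V) (2 * (s b + 1))).tendsto_nhds_of_unique_mapClusterPt ?_ ?_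
  · filter_upwards [hslim.eventually_lt_const (lt_add_one (s b))] with p hp
    rw [mem_closedBall_zero_iff]
    linarith [h.norm_le_two_mul (B p)]
  · intro y _ hy
    have hyK : y ∈ K := hK.mem_of_mapClusterPt hy (hev.mono fun p hp => (hB p hp).1)
    have hty : t y ≤ t b :=
      (isClosed_le h.continuous_snd continuous_const).mem_of_mapClusterPt hy (hev.mono htB)
    have hsy : s y = s b := by
      have := hy.tendsto_comp h.continuous_fst.continuousAt
      exact eq_of_nhds_neBot (this.neBot.mono (inf_le_inf_left _ hslim))
    refine IsLexMin.unique h hconv ⟨hyK, fun z hz => ?_⟩ hb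
    rw [hsy]
    exact (hb.2 z hz).imp_right fun h' => ⟨h'.1, hty.trans h'.2⟩

end SpectralPair

end SpectralApprox
namespace SpectralApprox

/-! ### Singular values of linear maps -/

section LinearMap

variable {E F : Type*} [NormedAddCommGroup E] [InnerProductSpace ℂ E] [FiniteDimensional ℂ E]
  [NormedAddCommGroup F] [InnerProductSpace ℂ F] [FiniteDimensional ℂ F]

open LinearMap

/-- An orthonormal basis of right singular vectors of `T`. -/
theorem exists_singular_basis (T : E →ₗ[ℂ] F) {n : ℕ} (hn : Module.finrank ℂ E = n) :
    ∃ e : OrthonormalBasis (Fin n) ℂ E, ∀ i j,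
      inner ℂ (T (e i)) (T (e j)) = if i = j then (T.singularValues i : ℂ) ^ 2 else 0 := by
  refine ⟨T.isSymmetric_adjoint_comp_self.eigenvectorBasis hn, fun i j => ?_⟩
  set e := T.isSymmetric_adjoint_comp_self.eigenvectorBasis hn with he
  have h1 : adjoint T (T (e j)) = ((T.singularValues j : ℝ) ^ 2 : ℂ) • e j := by
    have := T.isSymmetric_adjoint_comp_self.apply_eigenvectorBasis hn j
    rw [← T.sq_singularValues_fin hn, comp_apply, ← he] at this
    simpa only [Complex.coe_algebraMap, Complex.ofReal_pow] using! this
  rw [← adjoint_inner_right, h1, inner_smul_right, e.inner_eq_ite]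
  split_ifs with hij <;> simp [hij]

theorem norm_apply_singular_basis {T : E →ₗ[ℂ] F} {n : ℕ} {e : OrthonormalBasis (Fin n) ℂ E}
    (he : ∀ i j, inner ℂ (T (e i)) (T (e j)) = if i = j then (T.singularValues i : ℂ) ^ 2 else 0)
    (i : Fin n) : ‖T (e i)‖ = T.singularValues i := by
  have := inner_self_eq_norm_sq_to_K (𝕜 := ℂ) (T (e i))
  rw [he, if_pos rfl] at this
  have h2 : T.singularValues i ^ 2 = ‖T (e i)‖ ^ 2 := by
    apply Complex.ofReal_injective
    push_cast
    exact this
  exact ((sq_eq_sq₀ (T.singularValues_nonneg _) (norm_nonneg _)).mp h2).symm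

omit [FiniteDimensional ℂ F] in
theorem norm_sq_sum_of_orthogonal {n : ℕ} {u : Fin n → F}
    (hu : ∀ i j, i ≠ j → inner ℂ (u i) (u j) = 0) (c : Fin n → ℂ) :
    ‖∑ i, c i • u i‖ ^ 2 = ∑ i, ‖c i‖ ^ 2 * ‖u i‖ ^ 2 := by
  have : (‖∑ i, c i • u i‖ ^ 2 : ℂ) = ∑ i, (‖c i‖ ^ 2 * ‖u i‖ ^ 2 : ℂ) := by
    rw [← Complex.coe_algebraMap, ← inner_self_eq_norm_sq_to_K (𝕜 := ℂ), sum_inner]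
    refine Finset.sum_congr rfl fun i _ => ?_
    rw [inner_sum, Finset.sum_eq_single i]
    · rw [inner_smul_left, inner_smul_right, inner_self_eq_norm_sq_to_K, ← mul_assoc,
        RCLike.conj_mul]
    · intro j _ hj
      rw [inner_smul_left, inner_smul_right, hu i j hj.symm]
      simp
    · simp
  exact_mod_cast this

theorem norm_apply_le_singularValues_zero (T : E →ₗ[ℂ] F) (x : E) :
    ‖T x‖ ≤ T.singularValues 0 * ‖x‖ := by
  obtain ⟨e, he⟩ := exists_singular_basis T rfl
  have h0 := T.singularValues_nonneg 0
  refine le_of_sq_le_sq ?_ (by positivity)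
  have hx : T x = ∑ i, inner ℂ (e i) x • T (e i) := by
    conv_lhs => rw [← e.sum_repr' x]
    simp
  rw [hx, norm_sq_sum_of_orthogonal (fun i j hij => by rw [he, if_neg hij]), mul_pow,
    ← e.sum_sq_norm_inner_right x, Finset.mul_sum]
  refine Finset.sum_le_sum fun i _ => ?_
  rw [norm_apply_singular_basis he, mul_comm]
  gcongr
  · exact T.singularValues_nonneg _
  · exact T.singularValues_antitone (Nat.zero_le _)

/-- Both sides are the trace of T*T, computed in two orthonormal bases. -/
theorem sum_sq_singularValues (T : E →ₗ[ℂ] F) {n : ℕ} (b : OrthonormalBasis (Fin n) ℂ E) :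
    ∑ i : Fin n, T.singularValues i ^ 2 = ∑ i, ‖T (b i)‖ ^ 2 := by
  have hn : Module.finrank ℂ E = n := by simpa using Module.finrank_eq_card_basis b.toBasis
  obtain ⟨e, he⟩ := exists_singular_basis T hn
  have key : ∀ f : OrthonormalBasis (Fin n) ℂ E,
      ((∑ i, ‖T (f i)‖ ^ 2 : ℝ) : ℂ) = LinearMap.trace ℂ E (adjoint T ∘ₗ T) := fun f => by
    rw [LinearMap.trace_eq_sum_inner _ f]
    push_cast
    refine Finset.sum_congr rfl fun i _ => ?_
    rw [Function.comp_apply, adjoint_inner_right, inner_self_eq_norm_sq_to_K]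
    rfl
  have := (key e).trans (key b).symm
  rw [← Complex.ofReal_injective this]
  exact Finset.sum_congr rfl fun i _ => by rw [norm_apply_singular_basis he]

/-- With e₀ a top right singular vector of T, the support at T is S ↦ Re⟨T e₀, S e₀⟩ / σ₁(T); if
σ₁(T) = 0, division by zero gives the zero functional. -/
theorem hasSupport_singularValues_zero :
    HasSupport fun T : E →ₗ[ℂ] F => T.singularValues 0 := by
  intro T
  obtain ⟨e, he⟩ := exists_singular_basis T rfl
  rcases Nat.eq_zero_or_pos (Module.finrank ℂ E) with hn | hn
  · exact ⟨0, by simp [T.singularValues_of_finrank_le hn.le], fun S => S.singularValues_nonneg 0⟩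
  let i : Fin (Module.finrank ℂ E) := ⟨0, hn⟩
  have hT : ‖T (e i)‖ = T.singularValues 0 := norm_apply_singular_basis he i
  refine ⟨{ toFun := fun S => (inner ℂ (T (e i)) (S (e i))).re / T.singularValues 0
            map_add' := fun S S' => by simp [add_div]
            map_smul' := fun c S => by simp [mul_div_assoc] }, ?_, fun S => ?_⟩
  · simp only [coe_mk, AddHom.coe_mk]
    rw [he, if_pos rfl]
    have : ((T.singularValues (i : ℕ) : ℂ) ^ 2).re = T.singularValues 0 ^ 2 := by
      rw [← Complex.ofReal_pow, Complex.ofReal_re]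
    rw [this, sq, mul_self_div_self]
  · simp only [coe_mk, AddHom.coe_mk]
    refine div_le_of_le_mul₀ (T.singularValues_nonneg 0) (S.singularValues_nonneg 0) ?_
    refine (Complex.re_le_norm _).trans ((norm_inner_le_norm _ _).trans ?_)
    rw [hT, mul_comm]
    refine mul_le_mul_of_nonneg_right ?_ (T.singularValues_nonneg 0)
    simpa using norm_apply_le_singularValues_zero S (e i)

/-- Nuclear norm duality: the support at T is S ↦ Re tr(U*S), with U the partial isometry of the
polar decomposition of T. -/
theorem hasSupport_sum_singularValues {n : ℕ} (hn : Module.finrank ℂ E = n) :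
    HasSupport fun T : E →ₗ[ℂ] F => ∑ i : Fin n, T.singularValues i := by
  intro T
  obtain ⟨e, he⟩ := exists_singular_basis T hn
  -- The images U eᵢ; since 0⁻¹ = 0, they vanish on the kernel of T.
  let u : Fin n → F := fun i => ((T.singularValues i)⁻¹ : ℂ) • T (e i)
  have hu : ∀ i j, i ≠ j → inner ℂ (u i) (u j) = 0 := fun i j hij => by
    simp only [u]
    rw [inner_smul_left, inner_smul_right, he, if_neg hij]
    simp
  have hu1 : ∀ i, ‖u i‖ ≤ 1 := fun i => by
    simp only [u]
    rw [norm_smul, norm_apply_singular_basis he, norm_inv, Complex.norm_real, Real.norm_eq_abs,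
      abs_of_nonneg (T.singularValues_nonneg _)]
    exact inv_mul_le_one
  refine ⟨{ toFun := fun S => ∑ i, (inner ℂ (u i) (S (e i))).re
            map_add' := fun S S' => by simp [Finset.sum_add_distrib]
            map_smul' := fun c S => by simp [Finset.mul_sum] }, ?_, fun S => ?_⟩
  · simp only [coe_mk, AddHom.coe_mk]
    refine Finset.sum_congr rfl fun i _ => ?_
    simp only [u]
    rw [inner_smul_left, he, if_pos rfl, ← Complex.ofReal_inv, Complex.conj_ofReal,
      ← Complex.ofReal_pow, ← Complex.ofReal_mul, Complex.ofReal_re, sq, ← mul_assoc,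
      mul_comm, ← mul_assoc, mul_inv_mul_cancel]
  · simp only [coe_mk, AddHom.coe_mk]
    obtain ⟨f, hf⟩ := exists_singular_basis S hn
    -- W j is U fⱼ: the trace is recomputed in the right singular basis f of S, where ‖S fⱼ‖ = σⱼ(S)
    -- and U is a contraction.
    let W : Fin n → F := fun j => ∑ i, inner ℂ (e i) (f j) • u i
    have hW : ∀ j, ‖W j‖ ≤ 1 := fun j => by
      refine le_of_sq_le_sq ?_ zero_le_one
      simp only [W]
      rw [norm_sq_sum_of_orthogonal hu]
      calc _ ≤ ∑ i, ‖inner ℂ (e i) (f j)‖ ^ 2 * 1 := by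
            refine Finset.sum_le_sum fun i _ => mul_le_mul_of_nonneg_left ?_ (by positivity)
            exact pow_le_one₀ (norm_nonneg _) (hu1 i)
        _ = 1 ^ 2 := by
            simp only [mul_one]
            rw [e.sum_sq_norm_inner_right, f.norm_eq_one]
    have hsum : ∑ i, inner ℂ (u i) (S (e i)) = ∑ j, inner ℂ (W j) (S (f j)) := by
      have h1 : ∀ i, inner ℂ (u i) (S (e i)) =
          ∑ j, inner ℂ (f j) (e i) * inner ℂ (u i) (S (f j)) := fun i => by
        conv_lhs => rw [← f.sum_repr' (e i)]
        simp
      simp only [h1, W, sum_inner, inner_smul_left, inner_conj_symm]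
      exact Finset.sum_comm
    rw [← Complex.re_sum, hsum, Complex.re_sum]
    refine Finset.sum_le_sum fun j _ => ?_
    refine (Complex.re_le_norm _).trans ((norm_inner_le_norm _ _).trans ?_)
    rw [norm_apply_singular_basis hf]
    exact mul_le_of_le_one_left (S.singularValues_nonneg _) (hW j)

end LinearMap

/-! ### Reduction to two entries, padded by zeros -/

theorem sum_fin_eq_of_two {g : ℕ → ℝ} {k : ℕ} (hk : ∀ j, k ≤ j → g j = 0)
    (h2 : ∀ j, 2 ≤ j → g j = 0) : ∑ i : Fin k, g i = g 0 + g 1 := by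
  have key : ∀ a b, a ≤ b → (∀ j, a ≤ j → g j = 0) →
      ∑ i ∈ Finset.range a, g i = ∑ i ∈ Finset.range b, g i := fun a b hab ha => by
    refine Finset.sum_subset (Finset.range_mono hab) fun j _ hj => ha j ?_
    simpa using hj
  rw [Fin.sum_univ_eq_sum_range, key k (max k 2) (le_max_left _ _) hk,
    ← key 2 (max k 2) (le_max_right _ _) h2, Finset.sum_range_succ, Finset.sum_range_one]

theorem toLex_fin_le_iff {f g : ℕ → ℝ} {k : ℕ} (hk : k ≤ 2) (hf : ∀ j, k ≤ j → f j = 0)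
    (hg : ∀ j, k ≤ j → g j = 0) :
    toLex (fun i : Fin k => f i) ≤ toLex (fun i : Fin k => g i) ↔
      f 0 < g 0 ∨ f 0 = g 0 ∧ f 1 ≤ g 1 := by
  have key : toLex (fun i : Fin k => f i) < toLex (fun i : Fin k => g i) ↔
      ∃ i : Fin k, (∀ j : Fin k, j < i → f j = g j) ∧ f i < g i := Iff.rfl
  refine le_iff_lt_or_eq.trans ((or_congr key (toLex_inj.trans funext_iff)).trans ?_)
  interval_cases k
  · simp [hf, hg]
  · simp [hf 1 le_rfl, hg 1 le_rfl]
  · simp only [Fin.exists_fin_two, Fin.forall_fin_two]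
    simp [le_iff_lt_or_eq]
    tauto

/-! ### Transfer to matrices -/

section Matrix

variable {m n : ℕ}

theorem singularValues_toEuclideanLin_eq_zero (A : Matrix (Fin m) (Fin n) ℂ) {j : ℕ}
    (hj : min m n ≤ j) : (Matrix.toEuclideanLin A).singularValues j = 0 := by
  rw [LinearMap.singularValues_eq_zero_iff_le_finrank_range]
  refine le_trans (le_min ?_ ?_) hj
  · simpa using (LinearMap.range (Matrix.toEuclideanLin A)).finrank_le
  · simpa using LinearMap.finrank_range_le (Matrix.toEuclideanLin A)

theorem cpNorm_eq (hmn : min m n ≤ 2) (A : Matrix (Fin m) (Fin n) ℂ) {p : ℝ} (hp : 1 < p) :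
    cpNorm p A = ((Matrix.toEuclideanLin A).singularValues 0 ^ p +
      (Matrix.toEuclideanLin A).singularValues 1 ^ p) ^ (1 / p) := by
  unfold cpNorm sigma
  have hp0 : p ≠ 0 := by linarith
  have h0 : ∀ j, min m n ≤ j → (Matrix.toEuclideanLin A).singularValues j ^ p = 0 := fun j hj => by
    rw [singularValues_toEuclideanLin_eq_zero A hj, Real.zero_rpow hp0]
  rw [sum_fin_eq_of_two (g := fun j => (Matrix.toEuclideanLin A).singularValues j ^ p) h0
    fun j hj => h0 j (hmn.trans hj)]

theorem cpNorm_le_iff (hmn : min m n ≤ 2) (A B : Matrix (Fin m) (Fin n) ℂ) {p : ℝ} (hp : 1 < p) :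
    cpNorm p A ≤ cpNorm p B ↔
      (Matrix.toEuclideanLin A).singularValues 0 ^ p +
        (Matrix.toEuclideanLin A).singularValues 1 ^ p ≤
      (Matrix.toEuclideanLin B).singularValues 0 ^ p +
        (Matrix.toEuclideanLin B).singularValues 1 ^ p := by
  have hnn : ∀ X : Matrix (Fin m) (Fin n) ℂ, 0 ≤ (Matrix.toEuclideanLin X).singularValues 0 ^ p +
      (Matrix.toEuclideanLin X).singularValues 1 ^ p := fun X =>
    add_nonneg (Real.rpow_nonneg (LinearMap.singularValues_nonneg _ _) _)
      (Real.rpow_nonneg (LinearMap.singularValues_nonneg _ _) _)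
  rw [cpNorm_eq hmn A hp, cpNorm_eq hmn B hp]
  exact Real.rpow_le_rpow_iff (hnn A) (hnn B) (by positivity)

/-- The substitution B = A - X turns approximation from M into minimization over the affine set A -
M. -/
theorem forall_mem_iff_forall_sub {V : Type*} [AddCommGroup V] [Module ℝ V] (M : Submodule ℝ V)
    (A Y : V) {r q : V → V → Prop} (hrq : ∀ X X', r X X' ↔ q X X') :
    (Y ∈ (M : Set V) ∧ ∀ X ∈ (M : Set V), r (A - Y) (A - X)) ↔
      (A - Y ∈ {B | A - B ∈ M} ∧ ∀ B ∈ {B | A - B ∈ M}, q (A - Y) B) := by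
  refine and_congr (by simp) ⟨fun H B hB => ?_, fun H X hX => (hrq _ _).mpr (H _ (by simpa using hX))⟩
  have := (hrq _ _).mp (H (A - B) hB)
  rwa [sub_sub_cancel] at this

theorem isCpApprox_iff (hmn : min m n ≤ 2) (M : Submodule ℝ (Matrix (Fin m) (Fin n) ℂ))
    (A : Matrix (Fin m) (Fin n) ℂ) {p : ℝ} (hp : 1 < p) (Y : Matrix (Fin m) (Fin n) ℂ) :
    IsCpApprox (M : Set _) A p Y ↔
      SpectralPair.IsPowMin (fun A => (Matrix.toEuclideanLin A).singularValues 0)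
        (fun A => (Matrix.toEuclideanLin A).singularValues 1) {B | A - B ∈ M} p (A - Y) :=
  forall_mem_iff_forall_sub M A Y fun X X' => cpNorm_le_iff hmn X X' hp

theorem isStrictSpectralApprox_iff (hmn : min m n ≤ 2)
    (M : Submodule ℝ (Matrix (Fin m) (Fin n) ℂ)) (A Y : Matrix (Fin m) (Fin n) ℂ) :
    IsStrictSpectralApprox (M : Set _) A Y ↔
      SpectralPair.IsLexMin (fun A => (Matrix.toEuclideanLin A).singularValues 0)
        (fun A => (Matrix.toEuclideanLin A).singularValues 1) {B | A - B ∈ M} (A - Y) :=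
  forall_mem_iff_forall_sub M A Y
    (r := fun X X' => toLex (sigma X) ≤ toLex (sigma X')) fun X X' =>
    toLex_fin_le_iff hmn (fun _ hj => singularValues_toEuclideanLin_eq_zero X hj)
      (fun _ hj => singularValues_toEuclideanLin_eq_zero X' hj)

attribute [local instance] Matrix.frobeniusNormedAddCommGroup Matrix.frobeniusNormedSpace

theorem frobenius_sq (A : Matrix (Fin m) (Fin n) ℂ) : ‖A‖ ^ 2 = ∑ i, ∑ j, ‖A i j‖ ^ 2 := by
  rw [Matrix.frobenius_norm_def, ← Real.sqrt_eq_rpow, Real.sq_sqrt (by positivity)]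
  simp

theorem spectralPair_singularValues (hmn : min m n ≤ 2) :
    SpectralPair (fun A : Matrix (Fin m) (Fin n) ℂ => (Matrix.toEuclideanLin A).singularValues 0)
      (fun A => (Matrix.toEuclideanLin A).singularValues 1) := by
  have hz : ∀ (A : Matrix (Fin m) (Fin n) ℂ) j, 2 ≤ j →
      (Matrix.toEuclideanLin A).singularValues j = 0 := fun A j hj =>
    singularValues_toEuclideanLin_eq_zero A (hmn.trans hj)
  have hz' : ∀ (A : Matrix (Fin m) (Fin n) ℂ) j, n ≤ j →
      (Matrix.toEuclideanLin A).singularValues j = 0 := fun A j hj =>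
    singularValues_toEuclideanLin_eq_zero A ((min_le_right _ _).trans hj)
  have hpull : ∀ {f : (EuclideanSpace ℂ (Fin n) →ₗ[ℂ] EuclideanSpace ℂ (Fin m)) → ℝ},
      HasSupport f → HasSupport fun A : Matrix (Fin m) (Fin n) ℂ => f (Matrix.toEuclideanLin A) :=
    fun hf A => by
      obtain ⟨φ, h1, h2⟩ := hf (Matrix.toEuclideanLin A)
      exact ⟨φ ∘ₗ (Matrix.toEuclideanLin (𝕜 := ℂ) (m := Fin m)
        (n := Fin n)).toLinearMap.restrictScalars ℝ, h1, fun y => h2 _⟩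
  refine ⟨fun A => LinearMap.singularValues_nonneg _ _,
    fun A => LinearMap.singularValues_antitone _ zero_le_one, fun A => ?_, fun A B => ?_,
    hpull hasSupport_singularValues_zero, ?_⟩
  · have h := sum_sq_singularValues (Matrix.toEuclideanLin A) (EuclideanSpace.basisFun (Fin n) ℂ)
    rw [sum_fin_eq_of_two (g := fun j => (Matrix.toEuclideanLin A).singularValues j ^ 2)
      (fun j hj => by simp [hz' A j hj]) (fun j hj => by simp [hz A j hj])] at h
    rw [h, frobenius_sq, Finset.sum_comm]
    refine Finset.sum_congr rfl fun j _ => ?_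
    rw [EuclideanSpace.norm_sq_eq]
    simp [Matrix.toLpLin_apply]
  · simp only [frobenius_sq, Finset.mul_sum, ← Finset.sum_add_distrib]
    refine Finset.sum_congr rfl fun i _ => Finset.sum_congr rfl fun j _ => ?_
    have := parallelogram_law_with_norm ℝ (A i j) (B i j)
    simp only [Matrix.add_apply, Matrix.sub_apply]
    nlinarith
  -- The duality lemma sums over the domain dimension n, not min m n; the extra terms vanish.
  · have hsum : (fun A : Matrix (Fin m) (Fin n) ℂ => (Matrix.toEuclideanLin A).singularValues 0 +
        (Matrix.toEuclideanLin A).singularValues 1) =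
        fun A => ∑ i : Fin n, (Matrix.toEuclideanLin A).singularValues i :=
      funext fun A => (sum_fin_eq_of_two (hz' A) (hz A)).symm
    rw [hsum]
    exact hpull (hasSupport_sum_singularValues (n := n) (by simp))

end Matrix

end SpectralApprox

-- The approximation theorem

attribute [local instance] Matrix.frobeniusNormedAddCommGroup Matrix.frobeniusNormedSpace in
theorem mainTheorem4 (m n : ℕ) (hmn : m = 2 ∨ n = 2)
    (M : Submodule ℝ (Matrix (Fin m) (Fin n) ℂ)) (A : Matrix (Fin m) (Fin n) ℂ) :
    (∀ p : ℝ, 1 < p →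
      ∃! Y : Matrix (Fin m) (Fin n) ℂ, SpectralApprox.IsCpApprox (M : Set _) A p Y) ∧
    (∃! Y : Matrix (Fin m) (Fin n) ℂ, SpectralApprox.IsStrictSpectralApprox (M : Set _) A Y) ∧
    (∀ (Y : ℝ → Matrix (Fin m) (Fin n) ℂ) (Yst : Matrix (Fin m) (Fin n) ℂ),
      (∀ p : ℝ, 1 < p → SpectralApprox.IsCpApprox (M : Set _) A p (Y p)) →
      SpectralApprox.IsStrictSpectralApprox (M : Set _) A Yst →
      Tendsto Y atTop (𝓝 Yst)) := by
  have hmn' : min m n ≤ 2 := by omega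
  have h := SpectralApprox.spectralPair_singularValues hmn'
  set K : Set (Matrix (Fin m) (Fin n) ℂ) := {B | A - B ∈ M} with hKdef
  have hK : IsClosed K := M.closed_of_finiteDimensional.preimage (by fun_prop)
  have hconv : Convex ℝ K := by
    intro X hX Y hY a b _ _ hab
    have : A - (a • X + b • Y) = a • (A - X) + b • (A - Y) := by
      rw [smul_sub, smul_sub, sub_add_sub_comm, ← add_smul, hab, one_smul]
    change A - (a • X + b • Y) ∈ M
    rw [this]
    exact M.add_mem (M.smul_mem a hX) (M.smul_mem b hY)
  have hne : K.Nonempty := ⟨A, by simp [hKdef]⟩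
  have hcp : ∀ p, 1 < p → ∀ Y, SpectralApprox.IsCpApprox (M : Set _) A p Y ↔
      SpectralApprox.SpectralPair.IsPowMin _ _ K p (A - Y) := fun p hp Y =>
    SpectralApprox.isCpApprox_iff hmn' M A hp Y
  have hst : ∀ Y, SpectralApprox.IsStrictSpectralApprox (M : Set _) A Y ↔
      SpectralApprox.SpectralPair.IsLexMin _ _ K (A - Y) :=
    SpectralApprox.isStrictSpectralApprox_iff hmn' M A
  refine ⟨fun p hp => ?_, ?_, fun Y Yst hY hYst => ?_⟩
  · obtain ⟨B, hB⟩ := h.exists_isPowMin hK hne hp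
    refine ⟨A - B, (hcp p hp _).mpr (by rwa [sub_sub_cancel]), fun Y hY => ?_⟩
    rw [← SpectralApprox.SpectralPair.IsPowMin.unique h hconv hp ((hcp p hp Y).mp hY) hB,
      sub_sub_cancel]
  · obtain ⟨B, hB⟩ := h.exists_isLexMin hK hne
    refine ⟨A - B, (hst _).mpr (by rwa [sub_sub_cancel]), fun Y hY => ?_⟩
    rw [← SpectralApprox.SpectralPair.IsLexMin.unique h hconv ((hst Y).mp hY) hB, sub_sub_cancel]
  · have := h.tendsto_of_isPowMin hK hconv (B := fun p => A - Y p)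
      (fun p hp => (hcp p hp _).mp (hY p hp)) ((hst _).mp hYst)
    have hlim := this.const_sub A
    simp only [sub_sub_cancel] at hlim
    exact hlim
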